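/- Let $n\ge 3$. For a distribution $P$ on $\{0,1\}^n$ and a directed graph $G$ on $\{1,\dots,n\}$, where $\pi_G(v)$ is the set of parents of $v$, let $P_G(x)=\prod_{v} P(x_v\mid x_{\pi_G(v)})$ be the projection of $P$ onto $G$; $P$ is Markov with respect to $G$ if $P=P_G$. An orientation of an undirected graph $S$ is a directed graph obtained by choosing exactly one direction for each edge of $S$ (so its skeleton is $S$). Write $d_{\mathrm{KL}}(P\,\|\,Q)=\sum_x P(x)\log\frac{P(x)}{Q(x)}$. Theorem. There are absolute constants $c,\varepsilon_0>0$ such that for every $n\ge 3$ there is a forest $S$ on $\{1,\dots,n\}$ with the following property. Let $0<\varepsilon\le\varepsilon_0 n$ and $m\in\mathbb{N}$, and let $A$ be any (possibly randomized) algorithm, which may depend on $S$, $\varepsilon$ and $m$, that receives $m$ i.i.d. samples from an unknown distribution $P$ on $\{0,1\}^n$ and outputs an orientation $\hat G$ of $S$. Suppose that, for every orientation $G^*$ of $S$ with maximum in-degree at most $2$ and every $P$ that is Markov with respect to $G^*$, the output satisfies $d_{\mathrm{KL}}(P\,\|\,P_{\hat G})\le\varepsilon$ with probability at least $2/3$.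 Then $m\ge c\,n/\varepsilon$. In other words, even when the skeleton of $G^*$ is given, and even for in-degree $2$, learning an $\varepsilon$-close orientation of $G^*$ for distributions on $\{0,1\}^n$ takes $\Omega(n/\varepsilon)$ samples. -/

import Mathlib

/-- A digraph has no loops and no pair of opposite arcs, i.e. it orients each edge of its
skeleton in exactly one direction. -/
def IsOriented {V : Type*} (G : Digraph V) : Prop :=
  ∀ u v, G.Adj u v → ¬ G.Adj v u

/-- The orientations of the undirected graph `S`: oriented digraphs whose skeleton (the simple
graph obtained by forgetting directions) is `S`. When `S` is a forest these are precisely the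
polytrees with skeleton `S`. -/
def EdgeOrientation {V : Type*} (S : SimpleGraph V) : Type _ :=
  {G : Digraph V // IsOriented G ∧ G.toSimpleGraphInclusive = S}

/-- The set of parents of `v` in `G`. -/
noncomputable def parents {V : Type*} [Fintype V] (G : Digraph V) (v : V) : Finset V :=
  open Classical in Finset.univ.filter (fun u => G.Adj u v)

/-- The marginal probability `P(y_A = x_A)` that a sample `y` of `P` agrees with `x` on `A`. -/
noncomputable def marginal {V : Type*} [Fintype V] (P : PMF (V → Bool)) (A : Finset V)
    (x : V → Bool) : ℝ :=
  open Classical in ∑ y : V → Bool, if ∀ u ∈ A, y u = x u then (P y).toReal else 0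

/-- The projection `P_G(x) = ∏ᵥ P(x_v ∣ x_{π(v)})` of `P` onto `G`, where `π(v)` are the parents
of `v` in `G`. -/
noncomputable def projection {V : Type*} [Fintype V] (P : PMF (V → Bool)) (G : Digraph V)
    (x : V → Bool) : ℝ :=
  open Classical in ∏ v : V, marginal P (insert v (parents G v)) x / marginal P (parents G v) x

/-- `P` is Markov with respect to (i.e. is a Bayesian network on) `G`. -/
def IsMarkov {V : Type*} [Fintype V] (P : PMF (V → Bool)) (G : Digraph V) : Prop :=
  ∀ x, (P x).toReal = projection P G x

/-- The divergence `d_KL(P ‖ P_G) = ∑ₓ P(x) log (P(x) / P_G(x))`. Terms with `P(x) = 0` vanish,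
and `P_G(x) > 0` whenever `P(x) > 0` (see `projection_pos`), so no convention for division by
zero affects the value. -/
noncomputable def klProjection {V : Type*} [Fintype V] (P : PMF (V → Bool)) (G : Digraph V) : ℝ :=
  open Classical in
  ∑ x : V → Bool, (P x).toReal * Real.log ((P x).toReal / projection P G x)

theorem marginal_pos {V : Type*} [Fintype V] (P : PMF (V → Bool)) (A : Finset V) (x : V → Bool)
    (hx : P x ≠ 0) : 0 < marginal P A x := by
  classical
  unfold marginal
  refine Finset.sum_pos' (fun y _ => ?_) ⟨x, Finset.mem_univ _, ?_⟩
  · split_ifs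
    · exact ENNReal.toReal_nonneg
    · exact le_rfl
  · rw [if_pos (fun _ _ => rfl)]
    exact ENNReal.toReal_pos hx (P.apply_ne_top x)

theorem projection_pos {V : Type*} [Fintype V] (P : PMF (V → Bool)) (G : Digraph V) (x : V → Bool)
    (hx : P x ≠ 0) : 0 < projection P G x := by
  classical
  unfold projection
  exact Finset.prod_pos fun v _ => div_pos (marginal_pos P _ x hx) (marginal_pos P _ x hx)

/-- A (possibly randomized) learner that knows the skeleton `S`, receives `m` samples in
`{0,1}^V`, and outputs an orientation of `S`. -/
abbrev OrientationLearner {V : Type*} (S : SimpleGraph V) (m : ℕ) : Type _ :=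
  (Fin m → V → Bool) → PMF (EdgeOrientation S)

/-- The probability, over `m` i.i.d. samples from `P` and the internal randomness of the learner,
that the output `G` satisfies `d_KL(P ‖ P_G) ≤ ε`. -/
noncomputable def successProb {V : Type*} [Fintype V] {S : SimpleGraph V} {m : ℕ}
    (L : OrientationLearner S m) (P : PMF (V → Bool)) (ε : ℝ) : ENNReal :=
  open Classical in
  ∑ s : Fin m → V → Bool,
    (∏ i, P (s i)) * (L s).toOuterMeasure {G | klProjection P G.1 ≤ ε}

/-- With probability at least `2/3` the learner outputs an `ε`-close orientation, for every
distribution on `{0,1}^V` that is Markov with respect to some orientation of `S` of in-degree at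
most `d`. -/
def LearnsOrientation {V : Type*} [Fintype V] {S : SimpleGraph V} {m : ℕ}
    (L : OrientationLearner S m) (d : ℕ) (ε : ℝ) : Prop :=
  ∀ (P : PMF (V → Bool)) (Gstar : EdgeOrientation S),
    (∀ v, (parents Gstar.1 v).card ≤ d) → IsMarkov P Gstar.1 → 2 / 3 ≤ successProb L P ε

/-! The forest is `n / 3` disjoint three-vertex paths, plus leftover isolated vertices. Each path
hides one bit: its centre is a collider or it is not. With signs `p, q, r = ±1` along the path, the
collider density is `1 + pq/2 + t qr`, whose end coordinates are independent. The chain density adds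
`t pr/2`; since `q² = 1` it factors as `(1 + pq/2)(1 + t qr)`, so the ends are independent given the
centre. Both densities have the same marginals on the two edges, so only the weak correlation `t/2`
between the ends reveals the bit.

The correlation `1/2` on one edge does not shrink with `t`, which makes two quantities of order
`t²`. Flipping one bit changes the distribution by a relative amount at most `2t`, so the
`χ²`-divergence is at most `4t²` (`pathsWeight_update_sub_sq_le`). Getting one path wrong costs at
least `t²/144` in divergence (`le_blockKL`), and these costs add over paths
(`klProjection_pathsPMF`).

If `m t²` is small, `m` samples barely test any single bit, and Assouad's lemma
(`exists_le_expected_hamming`) gives a bit vector on which a constant fraction of the paths is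
misjudged on average. A successful output misjudges few of them, because its divergence is at most
`ε`. Taking `t²` proportional to `ε / n` makes these incompatible unless `m` is at least of order `n
/ ε`. -/

/-- The mean of `f` over the uniform distribution on the cube `{0,1}^V`. -/
noncomputable def cubeMean {V : Type*} [Fintype V] (f : (V → Bool) → ℝ) : ℝ :=
  open Classical in (1 / 2) ^ Fintype.card V * ∑ x : V → Bool, f x

theorem DependsOn.finset_prod {V ι : Type*} {F : ι → (V → Bool) → ℝ} {D : ι → Set V} {E : Set V}
    {s : Finset ι} (hF : ∀ b ∈ s, DependsOn (F b) (D b)) (hE : ∀ b ∈ s, D b ⊆ E) :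
    DependsOn (fun x => ∏ b ∈ s, F b x) E := fun _ _ hxy =>
  Finset.prod_congr rfl fun b hb => hF b hb fun i hi => hxy i (hE b hb hi)

/-! ### Averages over the uniform cube and independence -/

section CubeMean

variable {V : Type*} [Fintype V]

theorem cubeMean_const (c : ℝ) : cubeMean (fun _ : V → Bool => c) = c := by
  classical
  unfold cubeMean
  simp only [Finset.sum_const, Finset.card_univ, Fintype.card_fun, Fintype.card_bool,
    nsmul_eq_mul, Nat.cast_pow, Nat.cast_ofNat]
  rw [← mul_assoc, ← mul_pow]
  norm_num

/-- Functions of disjoint sets of coordinates are independent. -/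
theorem cubeMean_mul {f g : (V → Bool) → ℝ} {D : Set V} (hf : DependsOn f D)
    (hg : DependsOn g Dᶜ) :
    cubeMean (fun x => f x * g x) = cubeMean f * cubeMean g := by
  classical
  -- Exchanging the coordinates outside `D` between two independent copies preserves the uniform
  -- measure on pairs; it turns `f x * g y` into `f x * g x`.
  let sw : (V → Bool) × (V → Bool) → (V → Bool) × (V → Bool) :=
    fun p => (D.piecewise p.1 p.2, D.piecewise p.2 p.1)
  have hsw : Function.Involutive sw := by
    rintro ⟨x, y⟩
    simp only [sw, Prod.mk.injEq]
    constructor <;> ext i <;> by_cases hi : i ∈ D <;> simp [Set.piecewise, hi]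
  have key : (∑ x, f x) * ∑ y, g y = ∑ p : (V → Bool) × (V → Bool), f p.1 * g p.1 := by
    rw [Finset.sum_mul_sum, ← Finset.univ_product_univ, ← Finset.sum_product',
      Finset.univ_product_univ, ← Equiv.sum_comp (Function.Involutive.toPerm sw hsw)]
    refine Finset.sum_congr rfl fun p _ => ?_
    have h1 : f ((Function.Involutive.toPerm sw hsw) p).1 = f p.1 := hf fun i hi => by
      simp [sw, Set.piecewise, hi]
    have h2 : g ((Function.Involutive.toPerm sw hsw) p).2 = g p.1 := hg fun i hi => by
      simp [sw, Set.piecewise, show i ∉ D from hi]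
    rw [h1, h2]
  have key2 : ∑ p : (V → Bool) × (V → Bool), f p.1 * g p.1
      = 2 ^ Fintype.card V * ∑ x, f x * g x := by
    rw [Fintype.sum_prod_type]
    simp [Finset.mul_sum]
  have h2 : ((1 : ℝ) / 2) ^ Fintype.card V * 2 ^ Fintype.card V = 1 := by
    rw [← mul_pow]; norm_num
  unfold cubeMean
  calc _ = (1 / 2) ^ Fintype.card V * ((((1 : ℝ) / 2) ^ Fintype.card V * 2 ^ Fintype.card V) *
        ∑ x, f x * g x) := by rw [h2, one_mul]
    _ = (1 / 2) ^ Fintype.card V * (1 / 2) ^ Fintype.card V * ((∑ x, f x) * ∑ y, g y) := by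
        rw [key, key2]; ring
    _ = _ := by ring

theorem cubeMean_prod {ι : Type*} {F : ι → (V → Bool) → ℝ} {D : ι → Set V}
    (hF : ∀ b, DependsOn (F b) (D b)) (hD : Pairwise fun b c => Disjoint (D b) (D c))
    (s : Finset ι) :
    cubeMean (fun x => ∏ b ∈ s, F b x) = ∏ b ∈ s, cubeMean (F b) := by
  classical
  induction s using Finset.induction_on with
  | empty => simp [cubeMean_const]
  | insert b s hb ih =>
    simp only [Finset.prod_insert hb]
    rw [cubeMean_mul (hF b) (DependsOn.finset_prod (fun c _ => hF c) fun c hc => ?_), ih]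
    exact (hD (ne_of_mem_of_not_mem hc hb)).subset_compl_right

open Classical in
-- Flipping coordinate `u` preserves the sum, so that coordinate can be averaged out first.
theorem cubeMean_eq_update (f : (V → Bool) → ℝ) (u : V) :
    cubeMean f = cubeMean fun x =>
      (f (Function.update x u true) + f (Function.update x u false)) / 2 := by
  let fl : (V → Bool) → V → Bool := fun x => Function.update x u (!x u)
  have hfl : Function.Involutive fl := by
    intro x; simp [fl]
  have h := Equiv.sum_comp (Function.Involutive.toPerm fl hfl) f
  unfold cubeMean
  congr 1
  have h' : ∑ x, f x = ∑ x, (f x + f ((Function.Involutive.toPerm fl hfl) x)) / 2 := by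
    rw [← Finset.sum_div, Finset.sum_add_distrib, h]; ring
  rw [h']
  refine Finset.sum_congr rfl fun x _ => ?_
  have hx : Function.update x u (x u) = x := Function.update_eq_self u x
  simp only [Function.Involutive.coe_toPerm]
  cases hxu : x u <;> rw [hxu] at hx <;> simp [fl, hxu, hx, add_comm]

theorem cubeMean_coord (h : Bool → ℝ) (u : V) :
    cubeMean (fun x => h (x u)) = (∑ p, h p) / 2 := by
  classical
  rw [cubeMean_eq_update _ u]
  simp [cubeMean_const]

theorem cubeMean_triple (h : Bool → Bool → Bool → ℝ) {u v w : V} (huv : u ≠ v) (huw : u ≠ w)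
    (hvw : v ≠ w) :
    cubeMean (fun x => h (x u) (x v) (x w)) = (∑ p, ∑ q, ∑ r, h p q r) / 8 := by
  classical
  rw [cubeMean_eq_update _ u]
  simp only [Function.update_self, Function.update_of_ne huv.symm, Function.update_of_ne huw.symm]
  rw [cubeMean_eq_update _ v]
  simp only [Function.update_self, Function.update_of_ne hvw.symm]
  rw [cubeMean_eq_update _ w]
  simp only [Function.update_self, cubeMean_const, Fintype.sum_bool]
  ring

end CubeMean

/-! ### The two densities on a path -/

/-- The value `±1` of a bit. -/
noncomputable def boolSign (p : Bool) : ℝ := if p then 1 else -1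

/-- Densities on `{0,1}³` relative to the uniform distribution. For `chain = false` the outer
coordinates are independent; for `chain = true` they are independent given the middle one. -/
noncomputable def pathDensity (t : ℝ) (chain : Bool) (p q r : Bool) : ℝ :=
  1 + boolSign p * boolSign q / 2 + t * boolSign q * boolSign r +
    if chain then t / 2 * boolSign p * boolSign r else 0

theorem quarter_le_pathDensity {t : ℝ} (h0 : 0 ≤ t) (h1 : t ≤ 1 / 4) (c p q r : Bool) :
    1 / 4 ≤ pathDensity t c p q r := by
  cases c <;> cases p <;> cases q <;> cases r <;> norm_num [pathDensity, boolSign] <;> linarith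

theorem pathDensity_le_two {t : ℝ} (h0 : 0 ≤ t) (h1 : t ≤ 1 / 4) (c p q r : Bool) :
    pathDensity t c p q r ≤ 2 := by
  cases c <;> cases p <;> cases q <;> cases r <;> norm_num [pathDensity, boolSign] <;> linarith

theorem pathDensity_pos {t : ℝ} (h0 : 0 ≤ t) (h1 : t ≤ 1 / 4) (c p q r : Bool) :
    0 < pathDensity t c p q r :=
  lt_of_lt_of_le (by norm_num) (quarter_le_pathDensity h0 h1 c p q r)

theorem sum_pathDensity (t : ℝ) (c : Bool) : ∑ p, ∑ q, ∑ r, pathDensity t c p q r = 8 := by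
  cases c <;> simp [pathDensity, boolSign] <;> ring

/-! ### Product distributions over the paths and their marginals -/

section Blocks

variable {V ι : Type*} (e : ι × Fin 3 ↪ V)

/-- The function `h` of the three coordinates in the block `b`. -/
def onBlock (b : ι) (h : Bool → Bool → Bool → ℝ) (x : V → Bool) : ℝ :=
  h (x (e (b, 0))) (x (e (b, 1))) (x (e (b, 2)))

theorem dependsOn_onBlock (b : ι) (h : Bool → Bool → Bool → ℝ) :
    DependsOn (onBlock e b h) (Set.range fun i => e (b, i)) := fun x y hxy => by
  simp only [onBlock, hxy _ ⟨0, rfl⟩, hxy _ ⟨1, rfl⟩, hxy _ ⟨2, rfl⟩]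

theorem disjoint_block_range :
    Pairwise fun b c : ι => Disjoint (Set.range fun i => e (b, i)) (Set.range fun i => e (c, i)) :=
  fun b c hbc => by
    refine Set.disjoint_left.2 ?_
    rintro _ ⟨i, rfl⟩ ⟨j, hj⟩
    exact hbc (Prod.ext_iff.1 (e.injective hj)).1.symm

variable [Fintype V]

theorem cubeMean_onBlock (b : ι) (h : Bool → Bool → Bool → ℝ) :
    cubeMean (onBlock e b h) = (∑ p, ∑ q, ∑ r, h p q r) / 8 :=
  cubeMean_triple h (by simp) (by simp) (by simp)

theorem cubeMean_prod_pathDensity (t : ℝ) (θ : ι → Bool) (s : Finset ι) :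
    cubeMean (fun x => ∏ b ∈ s, onBlock e b (pathDensity t (θ b)) x) = 1 := by
  rw [cubeMean_prod (fun b => dependsOn_onBlock e b _) (disjoint_block_range e)]
  exact Finset.prod_eq_one fun b _ => by rw [cubeMean_onBlock, sum_pathDensity]; norm_num

variable [Fintype ι]

/-- The product over all blocks of `pathDensity`, with independent uniform bits elsewhere. -/
noncomputable def pathsWeight (t : ℝ) (θ : ι → Bool) (x : V → Bool) : ℝ :=
  (1 / 2) ^ Fintype.card V * ∏ b, onBlock e b (pathDensity t (θ b)) x

theorem pathsWeight_pos {t : ℝ} (h0 : 0 ≤ t) (h1 : t ≤ 1 / 4) (θ : ι → Bool) (x : V → Bool) :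
    0 < pathsWeight e t θ x :=
  mul_pos (by positivity) (Finset.prod_pos fun _ _ => pathDensity_pos h0 h1 _ _ _ _)

open Classical in
theorem sum_pathsWeight_mul (t : ℝ) (θ : ι → Bool) (h : (V → Bool) → ℝ) :
    ∑ x, pathsWeight e t θ x * h x =
      cubeMean fun x => (∏ b, onBlock e b (pathDensity t (θ b)) x) * h x := by
  unfold cubeMean pathsWeight
  rw [Finset.mul_sum]
  exact Finset.sum_congr rfl fun x _ => mul_assoc _ _ _

open Classical in
theorem sum_pathsWeight (t : ℝ) (θ : ι → Bool) : ∑ x, pathsWeight e t θ x = 1 := by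
  simpa [cubeMean_prod_pathDensity] using sum_pathsWeight_mul e t θ fun _ => 1

open Classical in
theorem sum_pathsWeight_mul_onBlock (t : ℝ) (θ : ι → Bool) (b : ι) (h : Bool → Bool → Bool → ℝ) :
    ∑ x, pathsWeight e t θ x * onBlock e b h x =
      (∑ p, ∑ q, ∑ r, pathDensity t (θ b) p q r * h p q r) / 8 := by
  rw [sum_pathsWeight_mul]
  have h1 : (fun x => (∏ c, onBlock e c (pathDensity t (θ c)) x) * onBlock e b h x) =
      fun x => onBlock e b (fun p q r => pathDensity t (θ b) p q r * h p q r) x *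
        ∏ c ∈ Finset.univ.erase b, onBlock e c (pathDensity t (θ c)) x := by
    ext x
    rw [← Finset.mul_prod_erase _ _ (Finset.mem_univ b)]
    simp only [onBlock]
    ring
  rw [h1, cubeMean_mul (dependsOn_onBlock e b _)
    (DependsOn.finset_prod (fun c _ => dependsOn_onBlock e c _) fun c hc => ?_),
    cubeMean_prod_pathDensity, mul_one, cubeMean_onBlock]
  exact (disjoint_block_range e (Finset.ne_of_mem_erase hc)).subset_compl_right

open Classical in
theorem sum_pathsWeight_mul_coord (t : ℝ) (θ : ι → Bool) {z : V} (hz : z ∉ Set.range e)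
    (h : Bool → ℝ) :
    ∑ x, pathsWeight e t θ x * h (x z) = (∑ p, h p) / 2 := by
  rw [sum_pathsWeight_mul, cubeMean_mul (D := Set.range e)
    (DependsOn.finset_prod (fun c _ => dependsOn_onBlock e c _) fun c _ => ?_) ?_,
    cubeMean_prod_pathDensity, one_mul, cubeMean_coord]
  · exact fun x y hxy => by rw [hxy z hz]
  · rintro _ ⟨i, rfl⟩
    exact ⟨_, rfl⟩

open Classical in
/-- The distribution with mass function `pathsWeight`. -/
noncomputable def pathsPMF (t : ℝ) (h0 : 0 ≤ t) (h1 : t ≤ 1 / 4) (θ : ι → Bool) :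
    PMF (V → Bool) :=
  PMF.ofFintype (fun x => ENNReal.ofReal (pathsWeight e t θ x)) (by
    rw [← ENNReal.ofReal_sum_of_nonneg fun x _ => (pathsWeight_pos e h0 h1 θ x).le,
      sum_pathsWeight, ENNReal.ofReal_one])

variable {t : ℝ} (h0 : 0 ≤ t) (h1 : t ≤ 1 / 4) (θ : ι → Bool)

theorem pathsPMF_toReal (x : V → Bool) :
    (pathsPMF e t h0 h1 θ x).toReal = pathsWeight e t θ x := by
  simp [pathsPMF, ENNReal.toReal_ofReal (pathsWeight_pos e h0 h1 θ x).le]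

/-- The other blocks integrate to 1, so an event `H` about one block is a sum of eight terms. -/
theorem marginal_pathsPMF_of_block (b : ι) {A : Finset V} {x : V → Bool}
    (H : Bool → Bool → Bool → Prop) [∀ p q r, Decidable (H p q r)]
    (hA : ∀ y : V → Bool, (∀ u ∈ A, y u = x u) ↔ H (y (e (b, 0))) (y (e (b, 1))) (y (e (b, 2)))) :
    marginal (pathsPMF e t h0 h1 θ) A x =
      (∑ p, ∑ q, ∑ r, if H p q r then pathDensity t (θ b) p q r else 0) / 8 := by
  classical
  have h := sum_pathsWeight_mul_onBlock e t θ b fun p q r => if H p q r then 1 else 0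
  simp only [mul_ite, mul_one, mul_zero] at h
  rw [← h]
  unfold marginal
  refine Finset.sum_congr rfl fun y _ => ?_
  simp only [hA, pathsPMF_toReal, onBlock, mul_ite, mul_one, mul_zero]

theorem marginal_pathsPMF_empty (x : V → Bool) : marginal (pathsPMF e t h0 h1 θ) ∅ x = 1 := by
  classical
  simp [marginal, pathsPMF_toReal, sum_pathsWeight]

theorem marginal_pathsPMF_isolated {z : V} (hz : z ∉ Set.range e) (x : V → Bool) :
    marginal (pathsPMF e t h0 h1 θ) {z} x = 1 / 2 := by
  classical
  have h := sum_pathsWeight_mul_coord e t θ hz fun p => if p = x z then 1 else 0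
  simpa [marginal, pathsPMF_toReal] using h

theorem marginal_pathsPMF_singleton (b : ι) (i : Fin 3) (x : V → Bool) :
    marginal (pathsPMF e t h0 h1 θ) {e (b, i)} x = 1 / 2 := by
  fin_cases i
  · rw [marginal_pathsPMF_of_block e h0 h1 θ b (fun p _ _ => p = x (e (b, 0))) (by simp)]
    cases x (e (b, 0)) <;> cases θ b <;> simp [pathDensity, boolSign] <;> ring
  · rw [marginal_pathsPMF_of_block e h0 h1 θ b (fun _ q _ => q = x (e (b, 1))) (by simp)]
    cases x (e (b, 1)) <;> cases θ b <;> simp [pathDensity, boolSign] <;> ring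
  · rw [marginal_pathsPMF_of_block e h0 h1 θ b (fun _ _ r => r = x (e (b, 2))) (by simp)]
    cases x (e (b, 2)) <;> cases θ b <;> simp [pathDensity, boolSign] <;> ring

open Classical in
-- The absence of `θ` on the right is the point here and in `marginal_pathsPMF_right`: edge
-- marginals carry no information about the hidden bit.
theorem marginal_pathsPMF_left (b : ι) (x : V → Bool) :
    marginal (pathsPMF e t h0 h1 θ) {e (b, 0), e (b, 1)} x =
      (1 + boolSign (x (e (b, 0))) * boolSign (x (e (b, 1))) / 2) / 4 := by
  rw [marginal_pathsPMF_of_block e h0 h1 θ b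
    (fun p q _ => p = x (e (b, 0)) ∧ q = x (e (b, 1))) (by simp)]
  cases x (e (b, 0)) <;> cases x (e (b, 1)) <;> cases θ b <;>
    simp [pathDensity, boolSign] <;> ring

open Classical in
theorem marginal_pathsPMF_right (b : ι) (x : V → Bool) :
    marginal (pathsPMF e t h0 h1 θ) {e (b, 2), e (b, 1)} x =
      (1 + t * boolSign (x (e (b, 1))) * boolSign (x (e (b, 2)))) / 4 := by
  rw [marginal_pathsPMF_of_block e h0 h1 θ b
    (fun _ q r => r = x (e (b, 2)) ∧ q = x (e (b, 1))) (by simp)]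
  cases x (e (b, 2)) <;> cases x (e (b, 1)) <;> cases θ b <;>
    simp [pathDensity, boolSign] <;> ring

open Classical in
theorem marginal_pathsPMF_ends (b : ι) (x : V → Bool) :
    marginal (pathsPMF e t h0 h1 θ) {e (b, 0), e (b, 2)} x =
      (1 + if θ b then t / 2 * boolSign (x (e (b, 0))) * boolSign (x (e (b, 2))) else 0) / 4 := by
  rw [marginal_pathsPMF_of_block e h0 h1 θ b
    (fun p _ r => p = x (e (b, 0)) ∧ r = x (e (b, 2))) (by simp)]
  cases x (e (b, 2)) <;> cases x (e (b, 0)) <;> cases θ b <;>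
    simp [pathDensity, boolSign] <;> ring

open Classical in
theorem marginal_pathsPMF_block (b : ι) (x : V → Bool) :
    marginal (pathsPMF e t h0 h1 θ) {e (b, 1), e (b, 0), e (b, 2)} x =
      onBlock e b (pathDensity t (θ b)) x / 8 := by
  rw [marginal_pathsPMF_of_block e h0 h1 θ b
    (fun p q r => q = x (e (b, 1)) ∧ p = x (e (b, 0)) ∧ r = x (e (b, 2))) (by simp)]
  simp only [onBlock]
  cases x (e (b, 2)) <;> cases x (e (b, 1)) <;> cases x (e (b, 0)) <;> simp

end Blocks

/-! ### The forest, its orientations and parent sets -/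

section Graphs

variable {V ι : Type*} (e : ι × Fin 3 ↪ V)

/-- Disjoint paths `e (b, 0) - e (b, 1) - e (b, 2)`, and isolated vertices elsewhere. -/
def pathsGraph : SimpleGraph V :=
  SimpleGraph.fromRel fun x y => ∃ b, x = e (b, 1) ∧ (y = e (b, 0) ∨ y = e (b, 2))

theorem pathsGraph_adj_end {b : ι} {i : Fin 3} (hi : i ≠ 1) (x : V) :
    (pathsGraph e).Adj x (e (b, i)) ↔ x = e (b, 1) := by
  simp only [pathsGraph, SimpleGraph.fromRel_adj, e.injective.eq_iff, Prod.mk.injEq, hi, and_false,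
    false_and, exists_false, or_false]
  constructor
  · rintro ⟨_, c, rfl, ⟨rfl, _⟩ | ⟨rfl, _⟩⟩ <;> rfl
  · rintro rfl
    refine ⟨by simp [hi.symm], b, rfl, ?_⟩
    fin_cases i <;> simp_all

theorem pathsGraph_adj_center {b : ι} (x : V) :
    (pathsGraph e).Adj x (e (b, 1)) ↔ x = e (b, 0) ∨ x = e (b, 2) := by
  simp only [pathsGraph, SimpleGraph.fromRel_adj, e.injective.eq_iff, Prod.mk.injEq]
  constructor
  · rintro ⟨_, ⟨c, rfl, ⟨rfl, h⟩ | ⟨rfl, h⟩⟩ | ⟨c, ⟨rfl, _⟩, h⟩⟩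
    · simp at h
    · simp at h
    · exact h
  · intro h
    refine ⟨?_, Or.inr ⟨b, by simp, h⟩⟩
    rcases h with rfl | rfl <;> simp

theorem not_pathsGraph_adj_isolated {z : V} (hz : z ∉ Set.range e) (x : V) :
    ¬ (pathsGraph e).Adj x z := by
  simp only [pathsGraph, SimpleGraph.fromRel_adj]
  rintro ⟨_, ⟨b, _, rfl | rfl⟩ | ⟨b, rfl, _⟩⟩ <;> exact hz ⟨_, rfl⟩

/-- An end vertex has the centre as its only neighbour, so deleting that edge isolates it. Hence
every edge is a bridge. -/
theorem pathsGraph_isAcyclic : (pathsGraph e).IsAcyclic := by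
  have key : ∀ (b : ι) (i : Fin 3), i ≠ 1 →
      (pathsGraph e).IsBridge s(e (b, 1), e (b, i)) := by
    intro b i hi
    rw [SimpleGraph.isBridge_iff]
    intro h
    obtain ⟨w⟩ := h.symm
    have hnil : ¬ w.Nil := SimpleGraph.Walk.not_nil_of_ne (by simpa using hi)
    have hadj := w.adj_snd hnil
    rw [SimpleGraph.deleteEdges_adj] at hadj
    rw [(pathsGraph_adj_end e hi _).1 hadj.1.symm] at hadj
    exact hadj.2 (by simp [Sym2.eq_swap])
  rw [SimpleGraph.isAcyclic_iff_forall_adj_isBridge]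
  intro v w hvw
  by_cases hw : w ∈ Set.range e
  · obtain ⟨⟨b, i⟩, rfl⟩ := hw
    by_cases hi : i = 1
    · subst hi
      rw [Sym2.eq_swap]
      rcases (pathsGraph_adj_center e v).1 hvw with rfl | rfl <;> exact key _ _ (by decide)
    · rw [(pathsGraph_adj_end e hi v).1 hvw]
      exact key _ _ hi
  · exact absurd hvw (not_pathsGraph_adj_isolated e hw v)

open Classical in
/-- Whether the block `b` is not oriented as a collider at its centre. -/
noncomputable def isChainAt (G : Digraph V) (b : ι) : Bool :=
  decide ¬ (G.Adj (e (b, 0)) (e (b, 1)) ∧ G.Adj (e (b, 2)) (e (b, 1)))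

/-- The orientation with forks in the blocks where `θ` holds, and colliders elsewhere. -/
def pathsDigraph (θ : ι → Bool) : Digraph V where
  Adj x y := ∃ b, ∃ i : Fin 3, i ≠ 1 ∧
    if θ b then x = e (b, 1) ∧ y = e (b, i) else x = e (b, i) ∧ y = e (b, 1)

theorem pathsDigraph_adj_center (θ : ι → Bool) (b : ι) {i : Fin 3} (hi : i ≠ 1) :
    (pathsDigraph e θ).Adj (e (b, i)) (e (b, 1)) ↔ θ b = false := by
  simp only [pathsDigraph]
  constructor
  · rintro ⟨c, j, hj, h⟩
    split_ifs at h with hc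
    · simp [hi] at h
    · simp only [e.injective.eq_iff, Prod.mk.injEq] at h
      simpa [h.1.1] using hc
  · intro h
    exact ⟨b, i, hi, by simp [h]⟩

theorem isChainAt_pathsDigraph (θ : ι → Bool) : isChainAt e (pathsDigraph e θ) = θ := by
  ext b
  simp only [isChainAt, pathsDigraph_adj_center e θ b (show (0 : Fin 3) ≠ 1 by decide),
    pathsDigraph_adj_center e θ b (show (2 : Fin 3) ≠ 1 by decide)]
  cases θ b <;> simp

theorem isOriented_pathsDigraph (θ : ι → Bool) : IsOriented (pathsDigraph e θ) := by
  rintro x y ⟨b, i, hi, h⟩ ⟨c, j, hj, h'⟩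
  split_ifs at h h' with hb hc hc <;> obtain ⟨rfl, rfl⟩ := h <;>
    simp only [e.injective.eq_iff, Prod.mk.injEq] at h' <;> simp_all

theorem toSimpleGraphInclusive_pathsDigraph (θ : ι → Bool) :
    (pathsDigraph e θ).toSimpleGraphInclusive = pathsGraph e := by
  ext x y
  simp only [Digraph.toSimpleGraphInclusive, pathsGraph, SimpleGraph.fromRel_adj, pathsDigraph]
  refine and_congr_right fun _ => ?_
  constructor
  · rintro (⟨b, i, hi, h⟩ | ⟨b, i, hi, h⟩) <;> split_ifs at h <;> obtain ⟨rfl, rfl⟩ := h <;>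
      fin_cases i <;> simp at hi ⊢
  · rintro (⟨b, rfl, rfl | rfl⟩ | ⟨b, rfl, rfl | rfl⟩) <;> cases hb : θ b
    · exact Or.inr ⟨b, 0, by decide, by simp [hb]⟩
    · exact Or.inl ⟨b, 0, by decide, by simp [hb]⟩
    · exact Or.inr ⟨b, 2, by decide, by simp [hb]⟩
    · exact Or.inl ⟨b, 2, by decide, by simp [hb]⟩
    · exact Or.inl ⟨b, 0, by decide, by simp [hb]⟩
    · exact Or.inr ⟨b, 0, by decide, by simp [hb]⟩
    · exact Or.inl ⟨b, 2, by decide, by simp [hb]⟩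
    · exact Or.inr ⟨b, 2, by decide, by simp [hb]⟩

/-- `pathsDigraph` as an orientation of `pathsGraph`. -/
def pathsOrientation (θ : ι → Bool) : EdgeOrientation (pathsGraph e) :=
  ⟨pathsDigraph e θ, isOriented_pathsDigraph e θ, toSimpleGraphInclusive_pathsDigraph e θ⟩

theorem EdgeOrientation.adj_of_adj {S : SimpleGraph V} (G : EdgeOrientation S) {x y : V}
    (h : G.1.Adj x y) : S.Adj x y := by
  obtain ⟨G, ho, rfl⟩ := G
  exact (SimpleGraph.fromRel_adj _ _ _).2 ⟨fun hxy => ho x y h (by rwa [hxy] at h ⊢), Or.inl h⟩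

theorem EdgeOrientation.adj_swap_iff {S : SimpleGraph V} (G : EdgeOrientation S) {x y : V}
    (h : S.Adj x y) : G.1.Adj y x ↔ ¬ G.1.Adj x y := by
  obtain ⟨G, ho, rfl⟩ := G
  have := ((SimpleGraph.fromRel_adj _ _ _).1 h).2
  exact ⟨fun h1 h2 => ho _ _ h1 h2, this.resolve_left⟩

variable [Fintype V] (G : EdgeOrientation (pathsGraph e))

open Classical in
theorem parents_end (b : ι) {i : Fin 3} (hi : i ≠ 1) :
    parents G.1 (e (b, i)) = if G.1.Adj (e (b, i)) (e (b, 1)) then ∅ else {e (b, 1)} := by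
  have hS := (pathsGraph_adj_end e hi _).2 (rfl : e (b, 1) = e (b, 1))
  ext x
  simp only [parents, Finset.mem_filter, Finset.mem_univ, true_and]
  split_ifs with h
  · simp only [Finset.notMem_empty, iff_false]
    intro hx
    obtain rfl := (pathsGraph_adj_end e hi _).1 (G.adj_of_adj hx)
    exact (G.adj_swap_iff hS).1 h hx
  · rw [Finset.mem_singleton]
    refine ⟨fun hx => (pathsGraph_adj_end e hi _).1 (G.adj_of_adj hx), ?_⟩
    rintro rfl
    exact (G.adj_swap_iff hS.symm).2 h

open Classical in
theorem parents_center (b : ι) :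
    parents G.1 (e (b, 1)) = (if G.1.Adj (e (b, 0)) (e (b, 1)) then {e (b, 0)} else ∅) ∪
      if G.1.Adj (e (b, 2)) (e (b, 1)) then {e (b, 2)} else ∅ := by
  ext x
  simp only [parents, Finset.mem_filter, Finset.mem_univ, true_and, Finset.mem_union]
  constructor
  · intro h
    rcases (pathsGraph_adj_center e x).1 (G.adj_of_adj h) with rfl | rfl <;> simp [h]
  · rintro (h | h) <;> split_ifs at h with h' <;> simp_all

theorem parents_isolated {z : V} (hz : z ∉ Set.range e) : parents G.1 z = ∅ := by
  ext x
  simp only [parents, Finset.mem_filter, Finset.mem_univ, true_and, Finset.notMem_empty, iff_false]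
  exact fun h => not_pathsGraph_adj_isolated e hz x (G.adj_of_adj h)

theorem card_parents_le_two (v : V) : (parents G.1 v).card ≤ 2 := by
  classical
  by_cases hv : v ∈ Set.range e
  · obtain ⟨⟨b, i⟩, rfl⟩ := hv
    by_cases hi : i = 1
    · subst hi
      rw [parents_center]
      refine (Finset.card_union_le _ _).trans ?_
      split_ifs <;> simp
    · rw [parents_end e G b hi]
      split_ifs <;> simp
  · simp [parents_isolated e G hv]

end Graphs

/-! ### Projections and divergence, block by block -/

section Projection

variable {V ι : Type*} (e : ι × Fin 3 ↪ V) [Fintype V] [Fintype ι]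

open Classical in
theorem prod_eq_prod_blocks_mul (f : V → ℝ) :
    ∏ v, f v = (∏ b, f (e (b, 0)) * f (e (b, 1)) * f (e (b, 2))) *
      ∏ v ∈ (Finset.univ.map e)ᶜ, f v := by
  rw [← Finset.prod_mul_prod_compl (Finset.univ.map e), Finset.prod_map, Fintype.prod_prod_type]
  simp only [Fin.prod_univ_three]

/-- The density on a block of the projection of `pathDensity t θ` onto a chain or a collider. -/
noncomputable def projDensity (t : ℝ) (θ c : Bool) (p q r : Bool) : ℝ :=
  if c then pathDensity t true p q r
  else pathDensity t θ p q r / (1 + if θ then t / 2 * boolSign p * boolSign r else 0)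

theorem projDensity_self (t : ℝ) (θ : Bool) : projDensity t θ θ = pathDensity t θ := by
  ext p q r
  cases θ <;> simp [projDensity]

variable {t : ℝ} (h0 : 0 ≤ t) (h1 : t ≤ 1 / 4)

include h0 h1 in
theorem projDensity_pos (θ c p q r : Bool) : 0 < projDensity t θ c p q r := by
  unfold projDensity
  split_ifs
  · exact pathDensity_pos h0 h1 _ _ _ _
  · refine div_pos (pathDensity_pos h0 h1 _ _ _ _) ?_
    cases p <;> cases r <;> simp [boolSign] <;> linarith
  · simpa using pathDensity_pos h0 h1 _ _ _ _

variable (θ : ι → Bool) (G : EdgeOrientation (pathsGraph e))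

open Classical in
-- The three non-collider orientations are Markov equivalent: each gives the product of the edge
-- marginals over that of the centre, which is the chain density whatever `θ` is. A collider instead
-- replaces the marginal of the two ends by a product, dividing the block density by their joint
-- density.
theorem block_factor (b : ι) (x : V → Bool) (f : V → ℝ)
    (hf : ∀ v, f v = marginal (pathsPMF e t h0 h1 θ) (insert v (parents G.1 v)) x /
      marginal (pathsPMF e t h0 h1 θ) (parents G.1 v) x) :
    f (e (b, 0)) * f (e (b, 1)) * f (e (b, 2)) =
      onBlock e b (projDensity t (θ b) (isChainAt e G.1 b)) x / 8 := by
  have hswap0 := marginal_pathsPMF_left e h0 h1 θ b x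
  have hswap2 := marginal_pathsPMF_right e h0 h1 θ b x
  rw [Finset.pair_comm] at hswap0 hswap2
  simp only [hf, parents_end e G b (show (0 : Fin 3) ≠ 1 by decide),
    parents_end e G b (show (2 : Fin 3) ≠ 1 by decide), parents_center, isChainAt]
  by_cases hA : G.1.Adj (e (b, 0)) (e (b, 1)) <;> by_cases hB : G.1.Adj (e (b, 2)) (e (b, 1)) <;>
    simp only [hA, hB, if_true, if_false, Finset.union_empty, Finset.empty_union,
      LawfulSingleton.insert_empty_eq, ← Finset.insert_eq, marginal_pathsPMF_empty,
      marginal_pathsPMF_singleton, marginal_pathsPMF_left, marginal_pathsPMF_right,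
      marginal_pathsPMF_ends, marginal_pathsPMF_block, hswap0, hswap2, onBlock, projDensity,
      and_self, and_true, and_false, not_true, not_false_iff, decide_true,
      decide_false, Bool.false_eq_true]
  · have aux (D Y : ℝ) : 1 / 2 / 1 * (D / 8 / (Y / 4)) * (1 / 2 / 1) = D / Y / 8 := by ring
    exact aux _ _
  all_goals
    simp only [pathDensity, if_true]
    cases x (e (b, 2)) <;> cases x (e (b, 1)) <;> cases x (e (b, 0)) <;> simp [boolSign] <;> ring

theorem projection_pathsPMF (x : V → Bool) :
    projection (pathsPMF e t h0 h1 θ) G.1 x =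
      (1 / 2) ^ Fintype.card V *
        ∏ b, onBlock e b (projDensity t (θ b) (isChainAt e G.1 b)) x := by
  classical
  have hc := prod_eq_prod_blocks_mul e fun _ => (1 / 2 : ℝ)
  simp only [Finset.prod_const (s := (Finset.univ : Finset V)), Finset.card_univ] at hc
  rw [hc, mul_right_comm, ← Finset.prod_mul_distrib]
  unfold projection
  rw [prod_eq_prod_blocks_mul e]
  congr 1
  · refine Finset.prod_congr rfl fun b _ => ?_
    rw [block_factor e h0 h1 θ G b x _ fun v => rfl]
    ring
  · refine Finset.prod_congr rfl fun z hz => ?_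
    have hz : z ∉ Set.range e := by simpa using hz
    rw [parents_isolated e G hz]
    simp [marginal_pathsPMF_empty, marginal_pathsPMF_isolated e h0 h1 θ hz]

theorem isMarkov_pathsPMF :
    IsMarkov (pathsPMF e t h0 h1 θ) (pathsOrientation e θ).1 := fun x => by
  rw [projection_pathsPMF, pathsPMF_toReal, pathsWeight]
  simp only [pathsOrientation, isChainAt_pathsDigraph, projDensity_self]

/-- The divergence of the block density `pathDensity t θ` from its projection. -/
noncomputable def blockKL (t : ℝ) (θ c : Bool) : ℝ :=
  (∑ p, ∑ q, ∑ r, pathDensity t θ p q r *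
    Real.log (pathDensity t θ p q r / projDensity t θ c p q r)) / 8

theorem klProjection_pathsPMF :
    klProjection (pathsPMF e t h0 h1 θ) G.1 = ∑ b, blockKL t (θ b) (isChainAt e G.1 b) := by
  classical
  have key : ∀ x, Real.log ((pathsPMF e t h0 h1 θ x).toReal /
      projection (pathsPMF e t h0 h1 θ) G.1 x) = ∑ b, onBlock e b (fun p q r =>
        Real.log (pathDensity t (θ b) p q r / projDensity t (θ b) (isChainAt e G.1 b) p q r)) x := by
    intro x
    rw [projection_pathsPMF, pathsPMF_toReal, pathsWeight, mul_div_mul_left _ _ (by positivity),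
      ← Finset.prod_div_distrib, Real.log_prod]
    · rfl
    · exact fun b _ => (div_pos (pathDensity_pos h0 h1 _ _ _ _) (projDensity_pos h0 h1 _ _ _ _ _)).ne'
  unfold klProjection blockKL
  refine (Finset.sum_congr rfl fun x _ => by
    rw [key, pathsPMF_toReal, Finset.mul_sum]).trans ?_
  rw [Finset.sum_comm]
  exact Finset.sum_congr rfl fun b _ => sum_pathsWeight_mul_onBlock e t θ b _

end Projection

/-! ### Divergence cost of misorienting one path -/

theorem le_neg_log {y : ℝ} (h0 : 0 < y) (h4 : y ≤ 4) : 1 - y + (y - 1) ^ 2 / 9 ≤ -Real.log y := by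
  -- With `y = s²`, the bound `log s ≤ s - 1` gives `-log y ≥ 2 - 2s = 1 - y + (s - 1)²`; then `s +
  -- 1 ≤ 3` compares `(s - 1)²` with `(y - 1)²`.
  obtain ⟨s, hs, rfl⟩ : ∃ s : ℝ, 0 < s ∧ y = s ^ 2 :=
    ⟨√y, Real.sqrt_pos.2 h0, (Real.sq_sqrt h0.le).symm⟩
  have h2 : s ≤ 2 := by nlinarith
  have hl : Real.log (s ^ 2) ≤ 2 * (s - 1) := by
    rw [Real.log_pow]
    have := Real.log_le_sub_one_of_pos hs
    push_cast
    linarith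
  have : (s ^ 2 - 1) ^ 2 ≤ 9 * (s - 1) ^ 2 := by
    have h3 : (s + 1) ^ 2 ≤ 9 := by nlinarith
    have := mul_le_mul_of_nonneg_right h3 (sq_nonneg (s - 1))
    nlinarith
  nlinarith

/-- The linear term `p - q` is kept because it cancels when summed over two densities of equal mass.
-/
theorem le_mul_log_div {p q δ : ℝ} (hp : 0 < p) (hq : 0 < q) (hq4 : q ≤ 4 * p)
    (h : δ ^ 2 * p ^ 2 ≤ (q - p) ^ 2) :
    p - q + δ ^ 2 * p / 9 ≤ p * Real.log (p / q) := by
  have hy := le_neg_log (y := q / p) (by positivity) (by rw [div_le_iff₀ hp]; exact hq4)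
  rw [← Real.log_inv, inv_div] at hy
  have h2 := mul_le_mul_of_nonneg_left hy hp.le
  refine le_trans ?_ h2
  have : δ ^ 2 ≤ (q / p - 1) ^ 2 := by
    rw [div_sub_one hp.ne', div_pow, le_div_iff₀ (by positivity)]
    exact h
  have h3 : p * (q / p) = q := by field_simp
  have := mul_le_mul_of_nonneg_left this hp.le
  nlinarith

theorem sum_projDensity {t : ℝ} (h0 : 0 ≤ t) (h1 : t ≤ 1 / 4) (θ c : Bool) :
    ∑ p, ∑ q, ∑ r, projDensity t θ c p q r = 8 := by
  have h2 : 1 + t / 2 ≠ 0 := by linarith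
  have h3 : 2 - t ≠ 0 := by linarith
  have h4 : 1 + -(t / 2) = (2 - t) / 2 := by ring
  cases c
  · cases θ
    · simpa [projDensity] using sum_pathDensity t false
    · simp [projDensity, pathDensity, boolSign, h4]
      field_simp
      ring
  · simpa [projDensity] using sum_pathDensity t true

/-- The wrong projection adds `X = ±t/2` to a density at most 2, or divides the density by `1 + X ≤
2`; either way the relative change is at least `t/4`. -/
theorem projDensity_far {t : ℝ} (h0 : 0 ≤ t) (h1 : t ≤ 1 / 4) {θ c : Bool} (hc : c ≠ θ)
    (p q r : Bool) :
    projDensity t θ c p q r ≤ 4 * pathDensity t θ p q r ∧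
      (t / 4) ^ 2 * pathDensity t θ p q r ^ 2 ≤
        (projDensity t θ c p q r - pathDensity t θ p q r) ^ 2 := by
  have hp := quarter_le_pathDensity h0 h1 θ p q r
  have hp2 := pathDensity_le_two h0 h1 θ p q r
  obtain ⟨s, hs, hX⟩ : ∃ s : ℝ, s ^ 2 = 1 ∧ t / 2 * boolSign p * boolSign r = s * (t / 2) := by
    refine ⟨boolSign p * boolSign r, ?_, by ring⟩
    cases p <;> cases r <;> norm_num [boolSign]
  have hsabs : -1 ≤ s ∧ s ≤ 1 := by constructor <;> nlinarith
  have hX1 : s * (t / 2) ≤ 1 / 8 := by nlinarith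
  have hX2 : -(1 / 8) ≤ s * (t / 2) := by nlinarith
  have hXsq : (s * (t / 2)) ^ 2 = t ^ 2 / 4 := by rw [mul_pow, hs]; ring
  cases θ
  · obtain rfl : c = true := by cases c <;> simp_all
    have hq : projDensity t false true p q r = pathDensity t false p q r + s * (t / 2) := by
      simp [projDensity, pathDensity, hX]
    rw [hq]
    constructor
    · linarith
    · have : pathDensity t false p q r ^ 2 ≤ 4 := by nlinarith
      have := mul_le_mul_of_nonneg_left this (sq_nonneg (t / 4))
      rw [add_sub_cancel_left, hXsq]
      nlinarith
  · obtain rfl : c = false := by cases c <;> simp_all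
    have hq : projDensity t true false p q r = pathDensity t true p q r / (1 + s * (t / 2)) := by
      simp [projDensity, hX]
    rw [hq]
    generalize s * (t / 2) = X at *
    generalize pathDensity t true p q r = P at *
    have hpos : 0 < 1 + X := by linarith
    constructor
    · rw [div_le_iff₀ hpos]
      nlinarith
    · have h3 : P / (1 + X) - P = P * (-X / (1 + X)) := by field_simp; ring
      have h4 : t ^ 2 / 16 ≤ (-X / (1 + X)) ^ 2 := by
        rw [div_pow, le_div_iff₀ (by positivity), neg_sq, hXsq]
        have : (1 + X) ^ 2 ≤ 4 := by nlinarith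
        have := mul_le_mul_of_nonneg_left this (sq_nonneg t)
        linarith
      rw [h3, mul_pow]
      have := mul_le_mul_of_nonneg_left h4 (sq_nonneg P)
      linarith

theorem blockKL_self {t : ℝ} (h0 : 0 ≤ t) (h1 : t ≤ 1 / 4) (θ : Bool) : blockKL t θ θ = 0 := by
  simp [blockKL, projDensity_self, div_self (pathDensity_pos h0 h1 _ _ _ _).ne']

theorem le_blockKL {t : ℝ} (h0 : 0 ≤ t) (h1 : t ≤ 1 / 4) {θ c : Bool} (hc : c ≠ θ) :
    t ^ 2 / 144 ≤ blockKL t θ c := by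
  have h : ∑ p, ∑ q, ∑ r, (pathDensity t θ p q r - projDensity t θ c p q r +
      (t / 4) ^ 2 / 9 * pathDensity t θ p q r) ≤ ∑ p, ∑ q, ∑ r, pathDensity t θ p q r *
        Real.log (pathDensity t θ p q r / projDensity t θ c p q r) := by
    refine Finset.sum_le_sum fun p _ => Finset.sum_le_sum fun q _ => Finset.sum_le_sum fun r _ => ?_
    have h2 := projDensity_far h0 h1 hc p q r
    have h3 := le_mul_log_div (pathDensity_pos h0 h1 θ p q r) (projDensity_pos h0 h1 θ c p q r)
      h2.1 h2.2
    rwa [mul_div_right_comm] at h3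
  simp only [Finset.sum_add_distrib, Finset.sum_sub_distrib, ← Finset.mul_sum, sum_pathDensity,
    sum_projDensity h0 h1] at h
  unfold blockKL
  linarith

/-! ### Indistinguishability through the `χ²`-divergence -/

section Testing

variable {X : Type*} [Fintype X]

theorem sum_sq_div_le {P Q : X → ℝ} {r : ℝ} (hQ : ∀ x, 0 < Q x) (hP1 : ∑ x, P x = 1)
    (hQ1 : ∑ x, Q x = 1) (h : ∀ x, (P x - Q x) ^ 2 ≤ r ^ 2 * Q x ^ 2) :
    ∑ x, P x ^ 2 / Q x ≤ 1 + r ^ 2 := by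
  calc ∑ x, P x ^ 2 / Q x ≤ ∑ x, (2 * P x - Q x + r ^ 2 * Q x) := by
        refine Finset.sum_le_sum fun x _ => ?_
        rw [div_le_iff₀ (hQ x)]
        nlinarith [h x]
    _ = 1 + r ^ 2 := by
        simp only [Finset.sum_add_distrib, Finset.sum_sub_distrib, ← Finset.mul_sum, hP1, hQ1]
        ring

/-- Cauchy–Schwarz, splitting `(P - Q) φ` into `(P - Q) / √Q` and `√Q φ`. -/
theorem sum_sub_mul_sq_le {P Q φ : X → ℝ} (hQ : ∀ x, 0 < Q x) (hP1 : ∑ x, P x = 1)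
    (hQ1 : ∑ x, Q x = 1) (h0 : ∀ x, 0 ≤ φ x) (h1 : ∀ x, φ x ≤ 1) :
    (∑ x, P x * φ x - ∑ x, Q x * φ x) ^ 2 ≤ ∑ x, P x ^ 2 / Q x - 1 := by
  rw [← Finset.sum_sub_distrib]
  have h := Finset.sum_sq_le_sum_mul_sum_of_sq_le_mul Finset.univ
    (r := fun x => P x * φ x - Q x * φ x) (f := fun x => (P x - Q x) ^ 2 / Q x)
    (g := fun x => Q x * φ x ^ 2) (fun x _ => div_nonneg (sq_nonneg _) (hQ x).le)
    (fun x _ => mul_nonneg (hQ x).le (sq_nonneg _)) (fun x _ => by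
      have := (hQ x).ne'
      exact le_of_eq (by field_simp))
  have h2 : ∑ x, Q x * φ x ^ 2 ≤ 1 := by
    rw [← hQ1]
    exact Finset.sum_le_sum fun x _ =>
      mul_le_of_le_one_right (hQ x).le (pow_le_one₀ (h0 x) (h1 x))
  have h3 : ∑ x, (P x - Q x) ^ 2 / Q x = ∑ x, P x ^ 2 / Q x - 1 := by
    have : ∀ x, (P x - Q x) ^ 2 / Q x = P x ^ 2 / Q x - 2 * P x + Q x := fun x => by
      have := (hQ x).ne'
      field_simp
      ring
    simp only [this, Finset.sum_add_distrib, Finset.sum_sub_distrib, ← Finset.mul_sum, hP1, hQ1]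
    ring
  rw [← h3]
  exact h.trans (mul_le_of_le_one_right
    (Finset.sum_nonneg fun x _ => div_nonneg (sq_nonneg _) (hQ x).le) h2)

theorem sum_prod_eq_pow (m : ℕ) (f : X → ℝ) : ∑ s : Fin m → X, ∏ i, f (s i) = (∑ x, f x) ^ m := by
  classical
  rw [Finset.sum_pow', Fintype.piFinset_univ]

/-- The mass function of `m` independent samples. -/
def iidWeight (m : ℕ) (P : X → ℝ) (s : Fin m → X) : ℝ := ∏ i, P (s i)

theorem sum_iidWeight (m : ℕ) {P : X → ℝ} (hP1 : ∑ x, P x = 1) : ∑ s, iidWeight m P s = 1 := by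
  simp only [iidWeight, sum_prod_eq_pow, hP1, one_pow]

/-- Tests based on `m` samples cannot separate distributions at small `χ²`-divergence. -/
theorem sum_iidWeight_mul_sub_le {m : ℕ} {P Q : X → ℝ} {r : ℝ} (hQ : ∀ x, 0 < Q x)
    (hP1 : ∑ x, P x = 1) (hQ1 : ∑ x, Q x = 1)
    (h : ∀ x, (P x - Q x) ^ 2 ≤ r ^ 2 * Q x ^ 2) {η : ℝ} (hη : 0 ≤ η)
    (hm : (1 + r ^ 2) ^ m ≤ 1 + η ^ 2) {φ : (Fin m → X) → ℝ} (h0 : ∀ s, 0 ≤ φ s)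
    (h1 : ∀ s, φ s ≤ 1) :
    |∑ s, iidWeight m P s * φ s - ∑ s, iidWeight m Q s * φ s| ≤ η := by
  refine abs_le_of_sq_le_sq ?_ hη
  refine (sum_sub_mul_sq_le (Q := iidWeight m Q) (fun s => Finset.prod_pos fun i _ => hQ _)
    (sum_iidWeight m hP1) (sum_iidWeight m hQ1) h0 h1).trans ?_
  -- The second moment of the likelihood ratio is multiplicative over independent samples.
  have h2 : ∑ s, iidWeight m P s ^ 2 / iidWeight m Q s = (∑ x, P x ^ 2 / Q x) ^ m := by
    simp only [iidWeight, ← sum_prod_eq_pow, Finset.prod_div_distrib, Finset.prod_pow]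
  rw [h2]
  have h3 : (∑ x, P x ^ 2 / Q x) ^ m ≤ (1 + r ^ 2) ^ m := by
    refine pow_le_pow_left₀ (Finset.sum_nonneg fun x _ => ?_) (sum_sq_div_le hQ hP1 hQ1 h) m
    exact div_nonneg (sq_nonneg _) (hQ x).le
  linarith

end Testing

/-! ### Assouad's lemma -/

open Classical in
/-- Assouad's lemma for randomized estimators of a vector of bits. -/
theorem exists_le_expected_hamming {ι Ω Γ : Type*} [Fintype ι] [Fintype Ω] [Fintype Γ]
    (P : (ι → Bool) → Ω → ℝ) (hP1 : ∀ θ, ∑ s, P θ s = 1)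
    (κ : Ω → Γ → ℝ) (hκ0 : ∀ s γ, 0 ≤ κ s γ) (hκ1 : ∀ s, ∑ γ, κ s γ = 1) (est : Γ → ι → Bool)
    {η : ℝ} (htest : ∀ θ b (φ : Ω → ℝ), (∀ s, 0 ≤ φ s) → (∀ s, φ s ≤ 1) →
      |∑ s, P (Function.update θ b (!θ b)) s * φ s - ∑ s, P θ s * φ s| ≤ η) :
    ∃ θ, (1 - η) / 2 * Fintype.card ι ≤
      ∑ s, P θ s * ∑ γ, κ s γ * ∑ b, if est γ b = θ b then (0 : ℝ) else 1 := by
  set err : (ι → Bool) → ι → ℝ := fun θ b =>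
    ∑ s, P θ s * ∑ γ, κ s γ * if est γ b = θ b then (0 : ℝ) else 1
  -- Being wrong about bit `b` under `θ` is being right under its flip, so the two errors would sum
  -- to 1 if the sample laws agreed; `htest` allows a loss of `η`.
  have hpair : ∀ θ b, 1 - η ≤ err θ b + err (Function.update θ b (!θ b)) b := by
    intro θ b
    set φ : Ω → ℝ := fun s => ∑ γ, κ s γ * if est γ b = θ b then (0 : ℝ) else 1
    have hφ0 : ∀ s, 0 ≤ φ s := fun s =>
      Finset.sum_nonneg fun γ _ => mul_nonneg (hκ0 s γ) (by split_ifs <;> norm_num)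
    have hφ1 : ∀ s, φ s ≤ 1 := fun s => by
      rw [← hκ1 s]
      exact Finset.sum_le_sum fun γ _ => mul_le_of_le_one_right (hκ0 s γ) (by split_ifs <;> norm_num)
    have hflip : ∀ s, (∑ γ, κ s γ * if est γ b = Function.update θ b (!θ b) b then (0 : ℝ) else 1)
        = 1 - φ s := by
      intro s
      refine Eq.trans ?_ (congrArg (· - φ s) (hκ1 s))
      simp only [φ, ← Finset.sum_sub_distrib]
      refine Finset.sum_congr rfl fun γ _ => ?_
      rw [Function.update_self]
      cases est γ b <;> cases θ b <;> simp
    have h1 : err (Function.update θ b (!θ b)) b =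
        1 - ∑ s, P (Function.update θ b (!θ b)) s * φ s := by
      simp only [err, hflip, mul_sub, mul_one, Finset.sum_sub_distrib, hP1]
    have := (abs_le.1 (htest θ b φ hφ0 hφ1)).2
    rw [h1]
    simp only [err]
    linarith
  have hsum : ∀ b, ∑ _θ : ι → Bool, (1 - η) / 2 ≤ ∑ θ, err θ b := by
    intro b
    let fl : (ι → Bool) → ι → Bool := fun θ => Function.update θ b (!θ b)
    have hfl : Function.Involutive fl := fun θ => by simp [fl]
    have h1 := Equiv.sum_comp (Function.Involutive.toPerm fl hfl) fun θ => err θ b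
    have h2 : ∑ _θ : ι → Bool, (1 - η) ≤
        ∑ θ, (err θ b + err (Function.Involutive.toPerm fl hfl θ) b) :=
      Finset.sum_le_sum fun θ _ => hpair θ b
    rw [Finset.sum_add_distrib, h1] at h2
    rw [← Finset.sum_div]
    linarith
  have htot : ∑ _θ : ι → Bool, (1 - η) / 2 * Fintype.card ι ≤ ∑ θ, ∑ b, err θ b := by
    rw [Finset.sum_comm]
    refine le_trans (le_of_eq ?_) (Finset.sum_le_sum fun b _ => hsum b)
    simp
    ring
  obtain ⟨θ, -, hθ⟩ := Finset.exists_le_of_sum_le Finset.univ_nonempty htot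
  refine ⟨θ, hθ.trans (le_of_eq ?_)⟩
  simp only [err, Finset.mul_sum]
  rw [Finset.sum_comm]
  exact Finset.sum_congr rfl fun s _ => Finset.sum_comm

/-! ### Closeness of distributions differing in one bit -/

section Paths

variable {V ι : Type*} (e : ι × Fin 3 ↪ V) [Fintype V] [Fintype ι]

open Classical in
theorem pathsWeight_update_sub_sq_le {t : ℝ} (h0 : 0 ≤ t) (h1 : t ≤ 1 / 4) (θ : ι → Bool) (b : ι)
    (x : V → Bool) :
    (pathsWeight e t (Function.update θ b (!θ b)) x - pathsWeight e t θ x) ^ 2 ≤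
      (2 * t) ^ 2 * pathsWeight e t θ x ^ 2 := by
  unfold pathsWeight
  rw [← Finset.mul_prod_erase _ _ (Finset.mem_univ b),
    ← Finset.mul_prod_erase (a := b) _ (fun c => onBlock e c (pathDensity t (θ c)) x)
      (Finset.mem_univ b), Function.update_self]
  have hrest : ∏ c ∈ Finset.univ.erase b,
      onBlock e c (pathDensity t (Function.update θ b (!θ b) c)) x =
      ∏ c ∈ Finset.univ.erase b, onBlock e c (pathDensity t (θ c)) x :=
    Finset.prod_congr rfl fun c hc => by rw [Function.update_of_ne (Finset.ne_of_mem_erase hc)]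
  rw [hrest]
  generalize ∏ c ∈ Finset.univ.erase b, onBlock e c (pathDensity t (θ c)) x = R
  generalize ((1 : ℝ) / 2) ^ Fintype.card V = N
  simp only [onBlock]
  have hg := quarter_le_pathDensity h0 h1 (θ b) (x (e (b, 0))) (x (e (b, 1))) (x (e (b, 2)))
  -- The densities differ by exactly `t/2` in absolute value; being at least `1/4`, they differ
  -- relatively by at most `2t`.
  have hd : (pathDensity t (!θ b) (x (e (b, 0))) (x (e (b, 1))) (x (e (b, 2))) -
      pathDensity t (θ b) (x (e (b, 0))) (x (e (b, 1))) (x (e (b, 2)))) ^ 2 = t ^ 2 / 4 := by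
    cases θ b <;> cases x (e (b, 0)) <;> cases x (e (b, 2)) <;> simp [pathDensity, boolSign] <;>
      ring
  generalize pathDensity t (!θ b) (x (e (b, 0))) (x (e (b, 1))) (x (e (b, 2))) = A at *
  generalize pathDensity t (θ b) (x (e (b, 0))) (x (e (b, 1))) (x (e (b, 2))) = B at *
  have h2 : (A - B) ^ 2 ≤ (2 * t) ^ 2 * B ^ 2 := by
    have : (1 / 4) ^ 2 ≤ B ^ 2 := pow_le_pow_left₀ (by norm_num) hg 2
    have := mul_le_mul_of_nonneg_left this (sq_nonneg (2 * t))
    rw [hd]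
    linarith
  have := mul_le_mul_of_nonneg_left h2 (sq_nonneg (N * R))
  linarith

end Paths

/-! ### Success probability as a finite real sum -/

instance finite_edgeOrientation {V : Type*} [Finite V] (S : SimpleGraph V) :
    Finite (EdgeOrientation S) :=
  Finite.of_injective (fun G : EdgeOrientation S => G.1.Adj) fun _ _ h =>
    Subtype.ext (Digraph.ext h)

theorem successProb_ne_top {V : Type*} [Fintype V] {S : SimpleGraph V} {m : ℕ}
    (L : OrientationLearner S m) (P : PMF (V → Bool)) (ε : ℝ) : successProb L P ε ≠ ⊤ := by
  classical
  refine ENNReal.sum_ne_top.2 fun s _ => ENNReal.mul_ne_top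
    (ENNReal.prod_ne_top fun i _ => P.apply_ne_top _) (ne_top_of_le_ne_top ENNReal.one_ne_top ?_)
  rw [PMF.toOuterMeasure_apply, ← (L s).tsum_coe]
  exact ENNReal.tsum_le_tsum fun G => Set.indicator_le_self _ _ G

open Classical in
theorem toReal_successProb {V : Type*} [Fintype V] {S : SimpleGraph V}
    [Fintype (EdgeOrientation S)] {m : ℕ} (L : OrientationLearner S m) (P : PMF (V → Bool))
    (ε : ℝ) :
    (successProb L P ε).toReal = ∑ s, iidWeight m (fun x => (P x).toReal) s *
      ∑ G, (L s G).toReal * if klProjection P G.1 ≤ ε then 1 else 0 := by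
  have hL : ∀ s, (L s).toOuterMeasure {G | klProjection P G.1 ≤ ε} =
      ∑ G, if klProjection P G.1 ≤ ε then L s G else 0 := fun s => by
    rw [PMF.toOuterMeasure_apply_fintype]
    rfl
  unfold successProb
  have hfin : ∀ s G, (if klProjection P G.1 ≤ ε then L s G else 0) ≠ ⊤ := fun s G => by
    split_ifs
    · exact (L s).apply_ne_top G
    · exact ENNReal.zero_ne_top
  rw [ENNReal.toReal_sum (ENNReal.sum_ne_top.1 (successProb_ne_top L P ε))]
  refine Finset.sum_congr rfl fun s _ => ?_
  rw [ENNReal.toReal_mul, ENNReal.toReal_prod, hL, ENNReal.toReal_sum fun G _ => hfin s G]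
  congr 1
  refine Finset.sum_congr rfl fun G _ => ?_
  split_ifs <;> simp

theorem PMF.sum_toReal {α : Type*} [Fintype α] (p : PMF α) : ∑ a, (p a).toReal = 1 := by
  rw [← ENNReal.toReal_sum fun a _ => p.apply_ne_top a, ← tsum_fintype (L := .unconditional α), p.tsum_coe,
    ENNReal.toReal_one]

/-! ### The lower bound for disjoint paths -/

section Paths

variable {V ι : Type*} (e : ι × Fin 3 ↪ V) [Fintype V] [Fintype ι]

open Classical in
theorem hamming_le_klProjection {t : ℝ} (h0 : 0 ≤ t) (h1 : t ≤ 1 / 4) (θ : ι → Bool)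
    (G : EdgeOrientation (pathsGraph e)) :
    t ^ 2 / 144 * ∑ b, (if isChainAt e G.1 b = θ b then (0 : ℝ) else 1) ≤
      klProjection (pathsPMF e t h0 h1 θ) G.1 := by
  rw [klProjection_pathsPMF, Finset.mul_sum]
  refine Finset.sum_le_sum fun b _ => ?_
  split_ifs with h
  · rw [h, blockKL_self h0 h1, mul_zero]
  · rw [mul_one]
    exact le_blockKL h0 h1 h

/-- A learner for disjoint paths cannot succeed if the blocks cannot be told apart. -/
theorem not_learnsOrientation_pathsGraph [Nonempty ι] {t : ℝ} (h0 : 0 < t) (h1 : t ≤ 1 / 4) {m : ℕ}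
    (hm : (1 + (2 * t) ^ 2) ^ m ≤ 1 + (1 / 5) ^ 2) (L : OrientationLearner (pathsGraph e) m) :
    ¬ LearnsOrientation L 2 (t ^ 2 / 14400 * Fintype.card ι) := by
  classical
  intro hL
  have := Fintype.ofFinite (EdgeOrientation (pathsGraph e))
  set k := (Fintype.card ι : ℝ)
  have hk : 0 < k := Nat.cast_pos.2 Fintype.card_pos
  set ε := t ^ 2 / 14400 * k
  obtain ⟨θ, hθ⟩ := exists_le_expected_hamming (fun θ => iidWeight m (pathsWeight e t θ))
    (fun θ => sum_iidWeight m (sum_pathsWeight e t θ)) (fun s G => (L s G).toReal)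
    (fun s G => ENNReal.toReal_nonneg) (fun s => (L s).sum_toReal) (fun G => isChainAt e G.1)
    (η := 1 / 5) (fun θ b φ hφ0 hφ1 => sum_iidWeight_mul_sub_le (pathsWeight_pos e h0.le h1 θ)
      (sum_pathsWeight e t _) (sum_pathsWeight e t θ)
      (pathsWeight_update_sub_sq_le e h0.le h1 θ b) (by norm_num) hm hφ0 hφ1)
  have hsucc := hL (pathsPMF e t h0.le h1 θ) (pathsOrientation e θ) (card_parents_le_two e _)
    (isMarkov_pathsPMF e h0.le h1 θ)
  have hsucc' : (2 / 3 : ℝ) ≤ ∑ s, iidWeight m (pathsWeight e t θ) s *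
      ∑ G, (L s G).toReal *
        if klProjection (pathsPMF e t h0.le h1 θ) G.1 ≤ ε then 1 else 0 := by
    have h := toReal_successProb L (pathsPMF e t h0.le h1 θ) ε
    simp only [pathsPMF_toReal] at h
    have h2 := ENNReal.toReal_mono (successProb_ne_top L _ ε) hsucc
    rw [h] at h2
    simpa using h2
  -- Success forces at most `k / 100` wrong blocks, since each costs `t² / 144`; failure allows all
  -- `k`.
  have hpt : ∀ G : EdgeOrientation (pathsGraph e),
      ∑ b, (if isChainAt e G.1 b = θ b then (0 : ℝ) else 1) ≤
        k - 99 / 100 * k *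
          if klProjection (pathsPMF e t h0.le h1 θ) G.1 ≤ ε then 1 else 0 := by
    intro G
    split_ifs with hG
    · have h := (hamming_le_klProjection e h0.le h1 θ G).trans hG
      have : ε = t ^ 2 / 144 * (k / 100) := by ring
      rw [this] at h
      have := le_of_mul_le_mul_left h (by positivity)
      linarith
    · rw [mul_zero, sub_zero]
      calc _ ≤ ∑ _b : ι, (1 : ℝ) := Finset.sum_le_sum fun b _ => by split_ifs <;> norm_num
        _ = k := by simp [k]
  have hup : ∑ s, iidWeight m (pathsWeight e t θ) s * ∑ G, (L s G).toReal *
      ∑ b, (if isChainAt e G.1 b = θ b then (0 : ℝ) else 1) ≤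
      ∑ s, iidWeight m (pathsWeight e t θ) s * ∑ G, (L s G).toReal * (k - 99 / 100 * k *
          if klProjection (pathsPMF e t h0.le h1 θ) G.1 ≤ ε then 1 else 0) := by
    refine Finset.sum_le_sum fun s _ => mul_le_mul_of_nonneg_left ?_
      (Finset.prod_nonneg fun i _ => (pathsWeight_pos e h0.le h1 θ _).le)
    exact Finset.sum_le_sum fun G _ => mul_le_mul_of_nonneg_left (hpt G) ENNReal.toReal_nonneg
  have hinner : ∀ s, ∑ G, (L s G).toReal * (k - 99 / 100 * k *
          if klProjection (pathsPMF e t h0.le h1 θ) G.1 ≤ ε then 1 else 0) =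
      k - 99 / 100 * k * ∑ G, (L s G).toReal *
        if klProjection (pathsPMF e t h0.le h1 θ) G.1 ≤ ε then 1 else 0 := by
    intro s
    simp only [mul_sub, Finset.sum_sub_distrib, ← Finset.sum_mul, (L s).sum_toReal, one_mul,
      mul_left_comm _ (99 / 100 * k), ← Finset.mul_sum]
  simp only [hinner] at hup
  simp only [mul_sub, Finset.sum_sub_distrib, ← Finset.sum_mul,
    sum_iidWeight m (sum_pathsWeight e t θ), one_mul, mul_left_comm _ (99 / 100 * k),
    ← Finset.mul_sum] at hup
  -- Success probability `2/3` bounds the expected number of wrong blocks by `k - (99/100)(2/3)k =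
  -- 0.34k`, below the `0.4k` from Assouad's lemma with `η = 1/5`.
  have := mul_le_mul_of_nonneg_left hsucc' (by positivity : 0 ≤ 99 / 100 * k)
  have hkd : (Fintype.card ι : ℝ) = k := rfl
  rw [hkd] at hθ
  linarith

end Paths

/-! ### Choice of parameters -/

theorem mainTheorem2 :
    ∃ c > (0 : ℝ), ∃ ε₀ > (0 : ℝ), ∀ n : ℕ, 3 ≤ n →
      ∃ S : SimpleGraph (Fin n), S.IsAcyclic ∧
        ∀ ε : ℝ, 0 < ε → ε ≤ ε₀ * n →
          ∀ (m : ℕ) (L : OrientationLearner S m),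
            LearnsOrientation L 2 ε → c * n / ε ≤ m := by
  refine ⟨1 / 10 ^ 8, by norm_num, 1 / 10 ^ 7, by norm_num, fun n hn => ?_⟩
  let e : Fin (n / 3) × Fin 3 ↪ Fin n :=
    ⟨fun p => ⟨3 * p.1 + p.2, by omega⟩, fun p q h => by
      simp only [Fin.mk.injEq] at h
      ext <;> omega⟩
  refine ⟨pathsGraph e, pathsGraph_isAcyclic e, fun ε hε hεn m L hL => ?_⟩
  by_contra! hm
  have : Nonempty (Fin (n / 3)) := ⟨⟨0, by omega⟩⟩
  set k := (Fintype.card (Fin (n / 3)) : ℝ) with hk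
  -- The constant 5 is attained at `n = 5`, where only one path fits.
  have hnk : (n : ℝ) ≤ 5 * k := by
    have : n ≤ 5 * (n / 3) := by omega
    rw [hk, Fintype.card_fin]
    exact_mod_cast this
  have hk0 : 0 < k := by
    have : (3 : ℝ) ≤ n := by exact_mod_cast hn
    linarith
  have ht2 : √(14400 * ε / k) ^ 2 = 14400 * ε / k := Real.sq_sqrt (by positivity)
  -- This `t` solves `t² k / 14400 = ε`; the upper bound on `ε` keeps it below `1/4`.
  refine not_learnsOrientation_pathsGraph e (t := √(14400 * ε / k)) (m := m)
    (Real.sqrt_pos.2 (by positivity)) ?_ ?_ L ?_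
  · rw [Real.sqrt_le_left (by norm_num), div_le_iff₀ hk0]
    linarith
  · rw [mul_pow, ht2]
    have hmε : m * ε ≤ 1 / 10 ^ 8 * n := by
      rw [lt_div_iff₀ hε] at hm
      exact hm.le
    set u := 2 ^ 2 * (14400 * ε / k)
    have hu : m * u ≤ 3 / 1000 := by
      have : m * u = 57600 * (m * ε) / k := by ring
      rw [this, div_le_iff₀ hk0]
      linarith
    have hu0 : 0 ≤ u := by positivity
    calc (1 + u) ^ m ≤ Real.exp u ^ m :=
          pow_le_pow_left₀ (by positivity) (by linarith [Real.add_one_le_exp u]) m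
      _ = Real.exp (m * u) := (Real.exp_nat_mul _ _).symm
      _ ≤ Real.exp (3 / 1000) := Real.exp_le_exp.2 hu
      _ ≤ 1 / (1 - 3 / 1000) := Real.exp_bound_div_one_sub_of_interval (by norm_num) (by norm_num)
      _ ≤ 1 + (1 / 5) ^ 2 := by norm_num
  · rw [ht2]
    convert hL using 1
    field_simp
    exact hk.symm
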